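/- Let $f,d:\mathbb{R}^m\times\mathbb{R}\to\mathbb{R}^m$ be smooth, let $c\in\mathbb{R}^m$, let $b<B$, and let $U=\{y:\|y-c\|<B\}$ (all vector norms are Euclidean). Suppose that $U$ is a contraction region of the system $\dot x=f(x,t)$, that is, there are a rate $\lambda>0$ and a smooth field $M(y,t)$ of real $m\times m$ matrices, $y\in U$, symmetric and positive definite for $t\ge 0$, such that, with $J=\partial f/\partial y$ and $\dot M=\partial_t M+\sum_i(\partial_{y_i}M)f_i$, $$\dot M+MJ+J^{\top}M\preceq-2\lambda M\qquad\text{for all }y\in U,\ t\ge 0 .$$ Write $M=T(y,t)^{\top}T(y,t)$ with $T(y,t)\in\mathbb{R}^{m\times m}$, and let $\chi$ be a uniform upper bound on the condition number of $T$ over the region: there are constants $0<\sigma_{\min}\le\sigma_{\max}$ with $\sigma_{\max}/\sigma_{\min}\le\chi$ and $\sigma_{\min}\|v\|\le\|T(y,t)v\|\le\sigma_{\max}\|v\|$ for all $y\in U$, $t\ge0$, $v\in\mathbb{R}^m$. Let the disturbance satisfy $\|d(y,t)\|\le D$ for all $y\in U$, $t\ge 0$. Let $x(t)$, $t\ge0$,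 be a solution of $\dot x=f(x,t)$ that starts in, and stays for all $t\ge 0$ within, the inner ball $\{y:\|y-c\|<b\}$, and consider the perturbed system $$\dot x_p=f(x_p,t)+d(x_p,t)$$ with an initial state at distance $\|x(0)-x_p(0)\|\le b$ from $x(0)$. If $$B\ \ge\ b(\chi+1)+\frac{\chi D}{\lambda},$$ then the perturbed system with this initial state has a solution for all $t\ge 0$, and every solution of it (on $[0,\infty)$ or on any interval $[0,\tau)$) stays in the contraction region $U$ and satisfies, for all $t$ in that interval, with $R(t)=\|x(t)-x_p(t)\|$, $$R(t)\ \le\ \chi R(0)e^{-\lambda t}+\frac{D\chi}{\lambda}.$$ -/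

import Mathlib

open Set Metric
open scoped ContDiff

/-- The state space `ℝ^m` with the Euclidean norm. -/
abbrev State (m : ℕ) : Type := EuclideanSpace ℝ (Fin m)

/-- Linear endomorphisms of `ℝ^m`, i.e. real `m × m` matrices, with the spectral norm and the
Loewner order. -/
abbrev Op (m : ℕ) : Type := State m →L[ℝ] State m

/-- A function of time and state is smooth, jointly in both arguments, on `ℝ × U`. -/
def SmoothOn {m : ℕ} {F : Type*} [NormedAddCommGroup F] [NormedSpace ℝ F]
    (g : ℝ → State m → F) (U : Set (State m)) : Prop :=
  ContDiffOn ℝ ∞ (fun p : ℝ × State m => g p.1 p.2) (univ ×ˢ U)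

/-- The Jacobian `J = ∂f/∂x` at time `t` and state `x`. -/
noncomputable def jacobian {m : ℕ} (f : ℝ → State m → State m) (t : ℝ) (x : State m) : Op m :=
  fderiv ℝ (f t) x

/-- `Ṁ = ∂M/∂t + ∑ᵢ (∂M/∂xᵢ) fᵢ`, the total time derivative of the matrix field `M` along the
flow of `ẋ = f(x, t)`. -/
noncomputable def flowDeriv {m : ℕ} (f : ℝ → State m → State m) (M : ℝ → State m → Op m)
    (t : ℝ) (x : State m) : Op m :=
  fderiv ℝ (fun p : ℝ × State m => M p.1 p.2) (t, x) (1, f t x)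

/-- The open set `U` is a contraction region of the system `ẋ = f(x, t)`, `t ≥ 0`, with metric `M`
and rate `lam > 0`: `M` is a smooth field of symmetric positive definite matrices, and
`Ṁ + M J + Jᵀ M ≤ -2 lam M` holds at every point of `U` and every time `t ≥ 0`. -/
structure IsContractionRegion {m : ℕ} (f : ℝ → State m → State m) (M : ℝ → State m → Op m)
    (lam : ℝ) (U : Set (State m)) : Prop where
  rate_pos : 0 < lam
  smooth : SmoothOn M U
  symm : ∀ t, 0 ≤ t → ∀ x ∈ U, IsSelfAdjoint (M t x)
  posDef : ∀ t, 0 ≤ t → ∀ x ∈ U, ∀ v : State m, v ≠ 0 → 0 < inner ℝ v (M t x v)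
  lyapunov : ∀ t, 0 ≤ t → ∀ x ∈ U,
    flowDeriv f M t x + M t x ∘L jacobian f t x
      + ContinuousLinearMap.adjoint (jacobian f t x) ∘L M t x ≤ (-2 * lam) • M t x

/-- `chi` is an upper bound on the condition number of the matrix field `T`, uniformly over the
region `U` and the times `t ≥ 0`: all singular values of all the matrices `T(x, t)` lie in one
interval `[lo, hi]` with `0 < lo ≤ hi` and `hi / lo ≤ chi`. -/
def IsCondBound {m : ℕ} (T : ℝ → State m → Op m) (U : Set (State m)) (chi : ℝ) : Prop :=
  ∃ lo hi : ℝ, 0 < lo ∧ lo ≤ hi ∧ hi / lo ≤ chi ∧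
    ∀ t, 0 ≤ t → ∀ x ∈ U, ∀ v : State m, lo * ‖v‖ ≤ ‖T t x v‖ ∧ ‖T t x v‖ ≤ hi * ‖v‖

/-!
The distance between the nominal trajectory `x` and a perturbed trajectory `xp` is estimated by a
discrete form of the nonlinear variation-of-constants formula, so that no lengths of curves in the
metric `M` and no derivatives of the flow with respect to initial values are needed.

*Local contraction.* For two nearby trajectories `y`, `z` of `f` in the contraction region, with
`w = z - y`, the function `⟪w, M(t, y) w⟫ = ‖T(t, y) w‖²` decays at any rate below `2 lam`: its
derivative is the quadratic form of `Ṁ + M J + Jᵀ M` at `w` plus the linearisation error of `f`,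
which is small relative to `‖w‖`, uniformly on compact sets. Hence `‖w‖` decays at any rate
`k < lam`, up to the condition number `chi` (`IsContractionRegion.exists_local_contraction`).

*Chaining.* Join `x` to `xp` by a chain of trajectories of the undisturbed equation. Those that
start at time `0` on the segment from `x 0` to `xp 0` contribute at most
`chi ‖x 0 - xp 0‖ exp (-k t)` at time `t`. The one that leaves `xp` at time `(n + 1) h` starts
within about `D h` of the one that left it at time `n h`, and this gap is then contracted; all these
gaps together contribute at most about `chi D ∫ exp (-k (t - s)) ds ≤ chi D / k`. By the same
estimate, applied inductively along the chain, all its trajectories stay so close to `x` that they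
remain in a smaller ball inside `ball c B`, where local contraction holds
(`LocallyContracts.norm_sub_le_of_perturbation`). Finally `k` tends to `lam`.

*Existence and uniqueness.* For the trajectories of the chain, and a perturbed one, to exist,
`f` and `d` are cut off outside a ball slightly smaller than `ball c B`, which makes them bounded
and Lipschitz over compact time intervals. The estimate keeps the solutions in the ball where
nothing has been changed. Any other perturbed solution agrees with this one by uniqueness.
-/

/-! ### Integral curves on compact time intervals -/

section IntegralCurves

open scoped NNReal Topology

variable {E : Type*} [NormedAddCommGroup E] [NormedSpace ℝ E]

theorem IsIntegralCurveOn.hasDerivWithinAt_Ici {y : ℝ → E} {v : ℝ → E → E} {a b t : ℝ}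
    (hy : IsIntegralCurveOn y v (Icc a b)) (ht : t ∈ Ico a b) :
    HasDerivWithinAt y (v t (y t)) (Ici t) t :=
  (hy t (Ico_subset_Icc_self ht)).mono_of_mem_nhdsWithin <|
    Filter.mem_of_superset (Icc_mem_nhdsGE ht.2) (Icc_subset_Icc_left ht.1)

theorem IsIntegralCurveOn.congr_field {y : ℝ → E} {v w : ℝ → E → E} {s : Set ℝ}
    (hy : IsIntegralCurveOn y v s) (h : ∀ t ∈ s, w t (y t) = v t (y t)) :
    IsIntegralCurveOn y w s := fun t ht => by
  rw [h t ht]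
  exact hy t ht

/-- A solution of the perturbed equation `y' = v t y + e t y` drifts away from a solution of
`y' = v t y` with the same initial value at speed at most the Grönwall rate. -/
theorem norm_sub_le_gronwallBound {y z : ℝ → E} {v e : ℝ → E → E} {a b D : ℝ} {K : ℝ≥0}
    (hv : ∀ t ∈ Icc a b, LipschitzWith K (v t)) (he : ∀ t ∈ Icc a b, ∀ q, ‖e t q‖ ≤ D)
    (hz : IsIntegralCurveOn z (fun t q => v t q + e t q) (Icc a b))
    (hy : IsIntegralCurveOn y v (Icc a b)) (h : z a = y a) :
    ∀ t ∈ Icc a b, ‖z t - y t‖ ≤ gronwallBound 0 K D (t - a) := by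
  intro t ht
  have := dist_le_of_approx_trajectories_ODE_of_mem (v := v) (s := fun _ => univ) (K := K)
    (δ := 0) (εf := D) (εg := 0) (fun t ht => (hv t (Ico_subset_Icc_self ht)).lipschitzOnWith)
    hz.continuousOn (fun t ht => hz.hasDerivWithinAt_Ici ht)
    (fun t ht => by simpa [dist_eq_norm] using he t (Ico_subset_Icc_self ht) (z t))
    (fun _ _ => mem_univ _) hy.continuousOn (fun t ht => hy.hasDerivWithinAt_Ici ht)
    (fun t _ => by simp) (fun _ _ => mem_univ _) (by simp [h]) t ht
  simpa [dist_eq_norm] using this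

theorem norm_sub_le_of_lipschitz {y z : ℝ → E} {v : ℝ → E → E} {a b : ℝ} {K : ℝ≥0}
    (hv : ∀ t ∈ Icc a b, LipschitzWith K (v t))
    (hy : IsIntegralCurveOn y v (Icc a b)) (hz : IsIntegralCurveOn z v (Icc a b)) :
    ∀ t ∈ Icc a b, ‖z t - y t‖ ≤ ‖z a - y a‖ * Real.exp (K * (t - a)) := by
  intro t ht
  simpa [dist_eq_norm] using dist_le_of_trajectories_ODE_of_mem (v := v) (s := fun _ => univ)
    (fun t ht => (hv t (Ico_subset_Icc_self ht)).lipschitzOnWith) hz.continuousOn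
    (fun t ht => hz.hasDerivWithinAt_Ici ht) (fun _ _ => mem_univ _) hy.continuousOn
    (fun t ht => hy.hasDerivWithinAt_Ici ht) (fun _ _ => mem_univ _) le_rfl t ht

/-- A bounded Lipschitz field has a solution on the whole of `[a, b]` from every initial value. -/
theorem exists_isIntegralCurveOn_Icc [CompleteSpace E] {v : ℝ → E → E} {a b : ℝ} {K L : ℝ≥0}
    (hab : a ≤ b) (hv : ∀ t ∈ Icc a b, LipschitzWith K (v t))
    (hc : ∀ q, ContinuousOn (fun t => v t q) (Icc a b)) (hL : ∀ t ∈ Icc a b, ∀ q, ‖v t q‖ ≤ L)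
    (q : E) : ∃ y : ℝ → E, y a = q ∧ IsIntegralCurveOn y v (Icc a b) := by
  have h : IsPicardLindelof v (tmin := a) (tmax := b) ⟨a, left_mem_Icc.2 hab⟩ q
      (L * ⟨b - a, sub_nonneg.2 hab⟩) 0 L K :=
    { lipschitzOnWith := fun t ht => (hv t ht).lipschitzOnWith
      continuousOn := fun q _ => hc q
      norm_le := fun t ht q _ => hL t ht q
      mul_max_le := by
        rw [sub_self, max_eq_left (sub_nonneg.2 hab), NNReal.coe_zero, sub_zero]
        exact le_rfl }
  exact h.exists_eq_forall_mem_Icc_hasDerivWithinAt₀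

/-- Solutions of an equation with a `C¹` right-hand side are determined by their initial value. -/
theorem ContDiff.eqOn_of_isIntegralCurveOn [FiniteDimensional ℝ E] {v : ℝ → E → E}
    (hv : ContDiff ℝ 1 (fun p : ℝ × E => v p.1 p.2)) {a b : ℝ} {y z : ℝ → E}
    (hy : IsIntegralCurveOn y v (Icc a b)) (hz : IsIntegralCurveOn z v (Icc a b))
    (h : y a = z a) : EqOn y z (Icc a b) := by
  have hK : IsCompact (y '' Icc a b ∪ z '' Icc a b) :=
    (isCompact_Icc.image_of_continuousOn hy.continuousOn).union
      (isCompact_Icc.image_of_continuousOn hz.continuousOn)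
  set S := y '' Icc a b ∪ z '' Icc a b
  obtain ⟨K, hK⟩ := (hv.locallyLipschitz.locallyLipschitzOn
    (s := Icc a b ×ˢ S)).exists_lipschitzOnWith_of_compact (isCompact_Icc.prod hK)
  refine ODE_solution_unique_of_mem_Icc_right (s := fun _ => S) (K := K) (v := v)
    (fun t ht => ?_) hy.continuousOn (fun t ht => hy.hasDerivWithinAt_Ici ht)
    (fun t ht => Or.inl (mem_image_of_mem _ (Ico_subset_Icc_self ht))) hz.continuousOn
    (fun t ht => hz.hasDerivWithinAt_Ici ht)
    (fun t ht => Or.inr (mem_image_of_mem _ (Ico_subset_Icc_self ht))) h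
  refine LipschitzOnWith.of_dist_le_mul fun p hp q hq => ?_
  simpa [Prod.dist_eq] using hK.dist_le_mul (t, p) ⟨Ico_subset_Icc_self ht, hp⟩ (t, q)
    ⟨Ico_subset_Icc_self ht, hq⟩

/-- Solutions on all the intervals `[0, n]` fit together to a solution on `[0, ∞)`. -/
theorem ContDiff.exists_isIntegralCurveOn_Ici [FiniteDimensional ℝ E] {v : ℝ → E → E}
    (hv : ContDiff ℝ 1 (fun p : ℝ × E => v p.1 p.2)) {q : E}
    (h : ∀ b : ℝ, 0 ≤ b → ∃ y : ℝ → E, y 0 = q ∧ IsIntegralCurveOn y v (Icc 0 b)) :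
    ∃ y : ℝ → E, IsIntegralCurveOn y v (Ici 0) ∧ y 0 = q := by
  choose! Y hY0 hY using h
  have key : ∀ b t : ℝ, 0 ≤ t → t ≤ b → Y (t + 1) t = Y b t := fun b t ht htb =>
    hv.eqOn_of_isIntegralCurveOn ((hY (t + 1) (by linarith)).mono (Icc_subset_Icc_right (by simp)))
      ((hY b (ht.trans htb)).mono (Icc_subset_Icc_right htb))
      ((hY0 _ (by linarith)).trans (hY0 _ (ht.trans htb)).symm) ⟨ht, le_rfl⟩
  refine ⟨fun t => Y (t + 1) t, fun t (ht : 0 ≤ t) => ?_, hY0 _ (by norm_num)⟩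
  have hmem : Icc 0 (t + 1) ∈ 𝓝[Ici 0] t :=
    inter_mem_nhdsWithin _ (Iic_mem_nhds (lt_add_one t))
  refine ((hY (t + 1) (by linarith) t ⟨ht, by simp⟩).mono_of_mem_nhdsWithin
    hmem).congr_of_eventuallyEq ?_ rfl
  filter_upwards [hmem] with s hs using key _ _ hs.1 hs.2

end IntegralCurves

/-! ### Local contraction along trajectories -/

section Contraction

open scoped NNReal Topology

variable {m : ℕ}

/-- The Lyapunov inequality as a differential inequality for `⟪w, M w⟫ = ‖T w‖²`, where `w` is
the difference of two trajectories: `w' = J w + e`, and the remainder `e` of the linearisation is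
small compared with `w`. -/
theorem lyapunov_quadratic_le {M N J T : Op m} {lam lo hi eps : ℝ} (hlo : 0 < lo)
    (hMT : M = ContinuousLinearMap.adjoint T ∘L T)
    (hT : ∀ v, lo * ‖v‖ ≤ ‖T v‖ ∧ ‖T v‖ ≤ hi * ‖v‖)
    (hlyap : N + M ∘L J + ContinuousLinearMap.adjoint J ∘L M ≤ (-2 * lam) • M)
    (heps : 0 ≤ eps) (hhi : 0 ≤ hi) {w e : State m} (he : ‖e‖ ≤ eps * ‖w‖) :
    inner ℝ w (N w + M (J w + e)) + inner ℝ (J w + e) (M w)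
      ≤ -2 * (lam - eps * (hi / lo)) * ‖T w‖ ^ 2 := by
  have hM : ∀ u v, inner ℝ u (M v) = inner ℝ (T u) (T v) := fun u v => by
    rw [hMT, ContinuousLinearMap.comp_apply, ContinuousLinearMap.adjoint_inner_right]
  have h1 := ((ContinuousLinearMap.le_def _ _).1 hlyap).inner_nonneg_right w
  simp only [sub_apply, smul_apply,
    add_apply, ContinuousLinearMap.comp_apply, inner_sub_right,
    inner_add_right, inner_smul_right, ContinuousLinearMap.adjoint_inner_right, hM,
    real_inner_self_eq_norm_sq] at h1
  have h2 : inner ℝ (T w) (T e) ≤ eps * (hi / lo) * ‖T w‖ ^ 2 := by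
    have h3 : ‖T e‖ ≤ eps * (hi / lo) * ‖T w‖ :=
      calc ‖T e‖ ≤ hi * ‖e‖ := (hT e).2
        _ ≤ hi * (eps * ‖w‖) := by gcongr
        _ ≤ hi * (eps * (‖T w‖ / lo)) := by
          gcongr
          rw [le_div_iff₀ hlo, mul_comm]
          exact (hT w).1
        _ = eps * (hi / lo) * ‖T w‖ := by ring
    calc inner ℝ (T w) (T e) ≤ ‖T w‖ * ‖T e‖ := real_inner_le_norm _ _
      _ ≤ ‖T w‖ * (eps * (hi / lo) * ‖T w‖) := by gcongr
      _ = eps * (hi / lo) * ‖T w‖ ^ 2 := by ring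
  simp only [map_add, inner_add_right, inner_add_left, hM]
  rw [real_inner_comm (T w) (T e)]
  linarith [real_inner_comm (T w) (T (J w))]

/-- Two trajectories contract at the rate `lam - eps * (hi / lo)` as long as one of them stays in
the contraction region and the linearisation error between them is at most `eps` times their
distance. -/
theorem IsContractionRegion.norm_sub_le {f : ℝ → State m → State m} {M T : ℝ → State m → Op m}
    {lam lo hi eps : ℝ} {U : Set (State m)} (hM : IsContractionRegion f M lam U) (hU : IsOpen U)
    (hMT : ∀ t, 0 ≤ t → ∀ y ∈ U, M t y = ContinuousLinearMap.adjoint (T t y) ∘L T t y)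
    (hlo : 0 < lo) (hhi : 0 ≤ hi)
    (hT : ∀ t, 0 ≤ t → ∀ y ∈ U, ∀ v, lo * ‖v‖ ≤ ‖T t y v‖ ∧ ‖T t y v‖ ≤ hi * ‖v‖)
    (heps : 0 ≤ eps) {a b : ℝ} (ha : 0 ≤ a) {y z : ℝ → State m}
    (hy : IsIntegralCurveOn y f (Icc a b)) (hz : IsIntegralCurveOn z f (Icc a b))
    (hyU : ∀ t ∈ Icc a b, y t ∈ U)
    (hlin : ∀ t ∈ Icc a b,
      ‖f t (z t) - f t (y t) - jacobian f t (y t) (z t - y t)‖ ≤ eps * ‖z t - y t‖) :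
    ∀ t ∈ Icc a b, ‖z t - y t‖
      ≤ hi / lo * Real.exp (-(lam - eps * (hi / lo)) * (t - a)) * ‖z a - y a‖ := by
  intro t ht
  set k := lam - eps * (hi / lo)
  set w : ℝ → State m := fun s => z s - y s with hw
  set V : ℝ → ℝ := fun s => inner ℝ (w s) (M s (y s) (w s)) with hV
  set V' : ℝ → ℝ := fun s => inner ℝ (w s) (flowDeriv f M s (y s) (w s)
    + M s (y s) (f s (z s) - f s (y s))) + inner ℝ (f s (z s) - f s (y s)) (M s (y s) (w s))
  have hVT : ∀ s ∈ Icc a b, V s = ‖T s (y s) (w s)‖ ^ 2 := fun s hs => by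
    rw [hV]
    simp only
    rw [hMT s (ha.trans hs.1) _ (hyU s hs), ContinuousLinearMap.comp_apply,
      ContinuousLinearMap.adjoint_inner_right, real_inner_self_eq_norm_sq]
  have hder : ∀ s ∈ Icc a b, HasDerivWithinAt V (V' s) (Icc a b) s := fun s hs => by
    have hMd : HasFDerivAt (fun p : ℝ × State m => M p.1 p.2)
        (fderiv ℝ (fun p : ℝ × State m => M p.1 p.2) (s, y s)) (s, y s) :=
      ((hM.smooth.contDiffAt ((isOpen_univ.prod hU).mem_nhds
        ⟨mem_univ _, hyU s hs⟩)).differentiableAt (by simp)).hasFDerivAt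
    have h1 : HasDerivWithinAt (fun s => M s (y s)) (flowDeriv f M s (y s)) (Icc a b) s :=
      hMd.comp_hasDerivWithinAt (f := fun s => (s, y s)) s
        ((hasDerivWithinAt_id s _).prodMk (hy s hs))
    have h2 : HasDerivWithinAt w (f s (z s) - f s (y s)) (Icc a b) s := (hz s hs).sub (hy s hs)
    exact h2.inner ℝ (h1.clm_apply h2)
  have hder' : ∀ s ∈ Ico a b, HasDerivWithinAt V (V' s) (Ici s) s := fun s hs =>
    (hder s (Ico_subset_Icc_self hs)).mono_of_mem_nhdsWithin <|
      Filter.mem_of_superset (Icc_mem_nhdsGE hs.2) (Icc_subset_Icc_left hs.1)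
  have hbound : ∀ s ∈ Ico a b, V' s ≤ -2 * k * V s + 0 := fun s hs => by
    have hs' := Ico_subset_Icc_self hs
    have h0 := ha.trans hs.1
    have := lyapunov_quadratic_le (w := w s)
      (e := f s (z s) - f s (y s) - jacobian f s (y s) (w s)) hlo (hMT s h0 _ (hyU s hs'))
      (hT s h0 _ (hyU s hs')) (hM.lyapunov s h0 _ (hyU s hs')) heps hhi (hlin s hs')
    rw [add_sub_cancel, ← hVT s hs'] at this
    rw [add_zero]
    exact this
  have hgron := le_gronwallBound_of_liminf_deriv_right_le (f := V) (δ := V a)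
    (fun s hs => (hder s hs).continuousWithinAt)
    (fun s hs r hr => (hder' s hs).liminf_right_slope_le hr) le_rfl hbound t ht
  rw [gronwallBound_ε0, hVT t ht, hVT a ⟨le_rfl, ht.1.trans ht.2⟩] at hgron
  have hexp : Real.exp (-2 * k * (t - a)) = Real.exp (-k * (t - a)) ^ 2 := by
    rw [← Real.exp_nat_mul]
    congr 1
    push_cast
    ring
  rw [hexp, ← mul_pow] at hgron
  have h1 := (pow_le_pow_iff_left₀ (norm_nonneg _) (by positivity) two_ne_zero).1 hgron
  have h2 := (hT t (ha.trans ht.1) _ (hyU t ht) (w t)).1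
  have h3 := (hT a ha _ (hyU a ⟨le_rfl, ht.1.trans ht.2⟩) (w a)).2
  have h4 : lo * ‖w t‖ ≤ hi * ‖w a‖ * Real.exp (-k * (t - a)) :=
    h2.trans (h1.trans (by gcongr))
  calc ‖w t‖ = lo * ‖w t‖ / lo := by field_simp
    _ ≤ hi * ‖w a‖ * Real.exp (-k * (t - a)) / lo := by gcongr
    _ = _ := by ring

theorem SmoothOn.contDiff {F : Type*} [NormedAddCommGroup F] [NormedSpace ℝ F]
    {g : ℝ → State m → F} (hg : SmoothOn g univ) :
    ContDiff ℝ ∞ (fun p : ℝ × State m => g p.1 p.2) := by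
  rw [← contDiffOn_univ, ← univ_prod_univ]
  exact hg

/-- A smooth time-dependent field is differentiable in space uniformly on compact sets. -/
theorem SmoothOn.exists_linearisation_error_le {f : ℝ → State m → State m}
    (hf : SmoothOn f univ) (c : State m) (R b : ℝ) {eps : ℝ} (heps : 0 < eps) :
    ∃ r > 0, ∀ t ∈ Icc 0 b, ∀ y ∈ closedBall c R, ∀ z ∈ closedBall c R, ‖z - y‖ ≤ r →
      ‖f t z - f t y - jacobian f t y (z - y)‖ ≤ eps * ‖z - y‖ := by
  have hF : ContDiff ℝ ∞ (fun p : ℝ × State m => f p.1 p.2) := hf.contDiff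
  have hd : ∀ t y, HasFDerivAt (f t) (jacobian f t y) y := fun t y =>
    (((hF.comp (contDiff_prodMk_right t)).differentiable (by simp)) y).hasFDerivAt
  have hJ : ∀ p : ℝ × State m, jacobian f p.1 p.2 =
      fderiv ℝ (fun p : ℝ × State m => f p.1 p.2) p ∘L ContinuousLinearMap.inr ℝ ℝ (State m) :=
    fun p => (HasFDerivAt.comp (f := fun q => (p.1, q)) p.2
      (hF.differentiable (by simp) p).hasFDerivAt (hasFDerivAt_prodMk_right p.1 p.2)).fderiv
  have hJc : Continuous (fun p : ℝ × State m => jacobian f p.1 p.2) := by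
    simp only [hJ]
    exact (hF.continuous_fderiv (by simp)).clm_comp continuous_const
  obtain ⟨r, hr, h⟩ := Metric.uniformContinuousOn_iff_le.1
    ((isCompact_Icc.prod (isCompact_closedBall c R)).uniformContinuousOn_of_continuous
      (s := Icc 0 b ×ˢ closedBall c R) hJc.continuousOn) eps heps
  refine ⟨r, hr, fun t ht y hy z hz hzy => ?_⟩
  have hseg := (convex_closedBall c R).segment_subset hy hz
  refine Convex.norm_image_sub_le_of_norm_hasFDerivWithin_le' (s := segment ℝ y z)
    (fun q _ => (hd t q).hasFDerivWithinAt) (fun q hq => ?_) (convex_segment y z)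
    (left_mem_segment ℝ y z) (right_mem_segment ℝ y z)
  rw [← dist_eq_norm]
  refine h (t, q) ⟨ht, hseg hq⟩ (t, y) ⟨ht, hy⟩ ?_
  rw [Prod.dist_eq, dist_self, max_eq_right dist_nonneg, dist_eq_norm]
  exact (norm_sub_le_of_mem_segment hq).trans hzy

/-- Uniform local contraction. Let the Lipschitz field `g` agree with `f` on a closed ball inside
the contraction region. A solution of `y' = g t y` that starts close to one in a smaller ball
approaches it at any prescribed rate `k < lam`, up to the factor `hi / lo`. -/
theorem IsContractionRegion.exists_local_contraction {f g : ℝ → State m → State m}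
    {M T : ℝ → State m → Op m} {lam lo hi k B b R r : ℝ} {K : ℝ≥0} {c : State m}
    (hf : SmoothOn f univ) (hM : IsContractionRegion f M lam (ball c B))
    (hMT : ∀ t, 0 ≤ t → ∀ y ∈ ball c B, M t y = ContinuousLinearMap.adjoint (T t y) ∘L T t y)
    (hlo : 0 < lo) (hhi : 0 < hi)
    (hT : ∀ t, 0 ≤ t → ∀ y ∈ ball c B, ∀ v, lo * ‖v‖ ≤ ‖T t y v‖ ∧ ‖T t y v‖ ≤ hi * ‖v‖)
    (hk : k < lam) (hrR : r < R) (hRB : R < B)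
    (hg : ∀ t ∈ Icc 0 b, LipschitzWith K (g t))
    (hgf : ∀ t ∈ Icc 0 b, ∀ y ∈ closedBall c R, g t y = f t y) :
    ∃ δ > 0, ∀ a ∈ Icc 0 b, ∀ y z : ℝ → State m,
      IsIntegralCurveOn y g (Icc a b) → IsIntegralCurveOn z g (Icc a b) →
      (∀ t ∈ Icc a b, y t ∈ closedBall c r) → ‖z a - y a‖ ≤ δ →
      ∀ t ∈ Icc a b, ‖z t - y t‖ ≤ hi / lo * Real.exp (-k * (t - a)) * ‖z a - y a‖ := by
  have heps : 0 < (lam - k) * (lo / hi) := mul_pos (sub_pos.2 hk) (div_pos hlo hhi)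
  obtain ⟨ρ, hρ, hlin⟩ := hf.exists_linearisation_error_le c R b heps
  refine ⟨min ρ (R - r) * Real.exp (-(K * b)), by
    have := sub_pos.2 hrR
    positivity, fun a ha y z hy hz hyr hza => ?_⟩
  have hsub : Icc a b ⊆ Icc 0 b := Icc_subset_Icc_left ha.1
  have hclose : ∀ t ∈ Icc a b, ‖z t - y t‖ ≤ min ρ (R - r) := fun t ht => by
    have hm : 0 ≤ min ρ (R - r) := le_min hρ.le (sub_pos.2 hrR).le
    calc ‖z t - y t‖ ≤ ‖z a - y a‖ * Real.exp (K * (t - a)) :=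
          norm_sub_le_of_lipschitz (fun t ht => hg t (hsub ht)) hy hz t ht
      _ ≤ min ρ (R - r) * Real.exp (-(K * b)) * Real.exp (K * b) := by
          gcongr
          linarith [ht.2, ha.1]
      _ = min ρ (R - r) := by
          rw [mul_assoc, ← Real.exp_add, neg_add_cancel, Real.exp_zero, mul_one]
  have hyR : ∀ t ∈ Icc a b, y t ∈ closedBall c R := fun t ht =>
    closedBall_subset_closedBall hrR.le (hyr t ht)
  have hzR : ∀ t ∈ Icc a b, z t ∈ closedBall c R := fun t ht => by
    have h1 := mem_closedBall_iff_norm.1 (hyr t ht)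
    have h2 := (hclose t ht).trans (min_le_right _ _)
    rw [mem_closedBall_iff_norm, ← sub_add_sub_cancel (z t) (y t) c]
    exact (norm_add_le _ _).trans (by linarith)
  have := hM.norm_sub_le isOpen_ball hMT hlo hhi.le hT heps.le ha.1
    (hy.congr_field fun t ht => (hgf t (hsub ht) _ (hyR t ht)).symm)
    (hz.congr_field fun t ht => (hgf t (hsub ht) _ (hzR t ht)).symm)
    (fun t ht => closedBall_subset_ball hRB (hyR t ht))
    (fun t ht => hlin t (hsub ht) _ (hyR t ht) _ (hzR t ht)
      ((hclose t ht).trans (min_le_left _ _)))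
  have hrate : lam - (lam - k) * (lo / hi) * (hi / lo) = k := by
    field_simp
    ring
  rwa [hrate] at this

end Contraction

/-! ### Tracking: from local contraction to a bound on the perturbation -/

section Tracking

open scoped NNReal Topology

variable {E : Type*} [NormedAddCommGroup E] [NormedSpace ℝ E]

/-- Over a short time step `h`, the Grönwall drift at disturbance level `D` is at most
`D₁ ∫₀ʰ exp (-k s) ds` for any `D₁ > D`, because both sides vanish at `0` with slopes `D < D₁`. -/
theorem eventually_gronwallBound_le {K k D D₁ : ℝ} (hk : k ≠ 0) (hD : D < D₁) :
    ∀ᶠ h in 𝓝[>] (0 : ℝ), gronwallBound 0 K D h ≤ D₁ / k * (1 - Real.exp (-k * h)) := by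
  have h1 : HasDerivAt (fun h => D₁ / k * (1 - Real.exp (-k * h)) - gronwallBound 0 K D h)
      (D₁ - D) 0 := by
    have h2 := (((hasDerivAt_id (0 : ℝ)).const_mul (-k)).exp.const_sub 1).const_mul (D₁ / k)
    refine (h2.sub (hasDerivAt_gronwallBound 0 K D 0)).congr_deriv ?_
    simp [gronwallBound_x0, hk]
  have h3 := (hasDerivAt_iff_tendsto_slope.1 h1).mono_left
    (nhdsWithin_mono 0 fun h (hh : 0 < h) => hh.ne')
  filter_upwards [h3.eventually (lt_mem_nhds (sub_pos.2 hD)), self_mem_nhdsWithin] with h hh hpos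
  have hpos : 0 < h := hpos
  rw [slope_def_field, gronwallBound_x0] at hh
  simp only [mul_zero, Real.exp_zero, sub_self, sub_zero] at hh
  linarith [(div_pos_iff_of_pos_right hpos).1 hh]

/-- The field `g` contracts locally, with factor `A` and rate `k`, around every trajectory that
stays within distance `ρ` of the reference trajectory `x` until time `b`: trajectories that start
within `δ` of it approach it. The threshold `δ` does not depend on the starting time `a`. -/
def LocallyContracts (g : ℝ → E → E) (x : ℝ → E) (b ρ A k δ : ℝ) : Prop :=
  ∀ a ∈ Icc 0 b, ∀ y z : ℝ → E,
    IsIntegralCurveOn y g (Icc a b) → IsIntegralCurveOn z g (Icc a b) →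
    (∀ t ∈ Icc a b, ‖y t - x t‖ ≤ ρ) → ‖z a - y a‖ ≤ δ →
    ∀ t ∈ Icc a b, ‖z t - y t‖ ≤ A * Real.exp (-k * (t - a)) * ‖z a - y a‖

variable {g : ℝ → E → E} {x : ℝ → E} {b ρ A k δ : ℝ}

/-- One link of a chain of trajectories: if `y` is within `β * exp (-k t)` of the reference
trajectory and `z` starts at time `a` close to `y`, then `z` is within
`(β + A * exp (k a) * ‖z a - y a‖) * exp (-k t)` of the reference trajectory. -/
theorem LocallyContracts.norm_sub_le_of_link (hC : LocallyContracts g x b ρ A k δ)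
    {a β γ : ℝ} (ha : a ∈ Icc 0 b) {y z : ℝ → E} (hy : IsIntegralCurveOn y g (Icc a b))
    (hz : IsIntegralCurveOn z g (Icc a b))
    (hyx : ∀ t ∈ Icc a b, ‖y t - x t‖ ≤ β * Real.exp (-k * t))
    (hβ : ∀ t ∈ Icc a b, β * Real.exp (-k * t) ≤ ρ) (hδ : ‖z a - y a‖ ≤ δ)
    (hγ : β + A * Real.exp (k * a) * ‖z a - y a‖ ≤ γ) :
    ∀ t ∈ Icc a b, ‖z t - x t‖ ≤ γ * Real.exp (-k * t) := by
  intro t ht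
  have h1 := hC a ha y z hy hz (fun s hs => (hyx s hs).trans (hβ s hs)) hδ t ht
  have h2 : Real.exp (-k * (t - a)) = Real.exp (k * a) * Real.exp (-k * t) := by
    rw [← Real.exp_add]
    ring_nf
  calc ‖z t - x t‖ ≤ ‖z t - y t‖ + ‖y t - x t‖ := norm_sub_le_norm_sub_add_norm_sub _ _ _
    _ ≤ A * Real.exp (-k * (t - a)) * ‖z a - y a‖ + β * Real.exp (-k * t) :=
        add_le_add h1 (hyx t ht)
    _ = (β + A * Real.exp (k * a) * ‖z a - y a‖) * Real.exp (-k * t) := by rw [h2]; ring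
    _ ≤ γ * Real.exp (-k * t) := by gcongr

/-- Contraction towards the reference trajectory from a finite distance, by subdividing the segment
between the two initial values. -/
theorem LocallyContracts.norm_sub_le_of_segment (hC : LocallyContracts g x b ρ A k δ)
    (hb : 0 ≤ b) (hδ : 0 < δ) (hA : 0 ≤ A) (hk : 0 ≤ k)
    (hflow : ∀ q, ∃ y : ℝ → E, y 0 = q ∧ IsIntegralCurveOn y g (Icc 0 b))
    (hx : IsIntegralCurveOn x g (Icc 0 b)) {z : ℝ → E} (hz : IsIntegralCurveOn z g (Icc 0 b))
    (hρ : A * ‖z 0 - x 0‖ ≤ ρ) :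
    ∀ t ∈ Icc 0 b, ‖z t - x t‖ ≤ A * ‖z 0 - x 0‖ * Real.exp (-k * t) := by
  set r := ‖z 0 - x 0‖ with hr
  have hr0 : 0 ≤ r := norm_nonneg _
  have h0 : (0 : ℝ) ∈ Icc 0 b := ⟨le_rfl, hb⟩
  have hρ0 : 0 ≤ ρ := (mul_nonneg hA hr0).trans hρ
  obtain ⟨N, hN⟩ := exists_nat_gt (r / δ)
  have hN0 : (0 : ℝ) < N := lt_of_le_of_lt (by positivity) hN
  have hstep : r / N ≤ δ := by
    rw [div_le_iff₀ hN0]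
    rw [div_lt_iff₀ hδ] at hN
    linarith
  have key : ∀ n : ℕ, n ≤ N → ∀ y : ℝ → E, IsIntegralCurveOn y g (Icc 0 b) →
      y 0 = x 0 + ((n : ℝ) / N) • (z 0 - x 0) →
      ∀ t ∈ Icc 0 b, ‖y t - x t‖ ≤ A * ((n : ℝ) / N * r) * Real.exp (-k * t) := by
    intro n
    induction n with
    | zero =>
      intro _ y hy hy0
      have hyx : y 0 - x 0 = 0 := by simp [hy0]
      refine hC.norm_sub_le_of_link h0 hx hy (β := 0) (by simp) (fun _ _ => by simpa) ?_ ?_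
      · simpa [hyx] using hδ.le
      · simp [hyx]
    | succ n ih =>
      intro hn y hy hy0
      obtain ⟨u, hu0, hu⟩ := hflow (x 0 + ((n : ℝ) / N) • (z 0 - x 0))
      have hyu : ‖y 0 - u 0‖ = r / N := by
        have : y 0 - u 0 = (N : ℝ)⁻¹ • (z 0 - x 0) := by
          rw [hy0, hu0, add_sub_add_left_eq_sub, ← sub_smul]
          congr 1
          push_cast
          ring
        rw [this, norm_smul, norm_inv, Real.norm_natCast, ← hr]
        ring
      refine hC.norm_sub_le_of_link h0 hu hy (ih (by omega) u hu hu0) (fun t ht => ?_)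
        (hyu.trans_le hstep) ?_
      · have h1 : (n : ℝ) / N ≤ 1 := (div_le_one hN0).2 (by exact_mod_cast (by omega : n ≤ N))
        have h2 : Real.exp (-k * t) ≤ 1 := Real.exp_le_one_iff.2 (by nlinarith [ht.1])
        calc A * ((n : ℝ) / N * r) * Real.exp (-k * t) ≤ A * (1 * r) * 1 := by gcongr
          _ ≤ ρ := by simpa using hρ
      · rw [hyu, mul_zero, Real.exp_zero]
        push_cast
        apply le_of_eq
        ring
  intro t ht
  have := key N le_rfl z hz (by rw [div_self hN0.ne']; simp) t ht
  rwa [div_self hN0.ne', one_mul] at this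

/-- The tracking estimate. The solution `p` of the equation perturbed by a disturbance of size at
most `D` is compared with the undisturbed trajectories that leave it at the times `n h`: each of
them starts within the Grönwall drift of the preceding one, and this drift is contracted
afterwards. The sum of the contracted drifts is at most `A * D₁ / k`, for any `D₁ > D`. -/
theorem LocallyContracts.norm_sub_le_of_perturbation (hC : LocallyContracts g x b ρ A k δ)
    (hb : 0 ≤ b) (hδ : 0 < δ) (hA : 0 ≤ A) (hk : 0 < k) {K : ℝ≥0}
    (hg : ∀ t ∈ Icc 0 b, LipschitzWith K (g t))
    (hflow : ∀ a ∈ Icc 0 b, ∀ q, ∃ y : ℝ → E, y a = q ∧ IsIntegralCurveOn y g (Icc a b))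
    (hx : IsIntegralCurveOn x g (Icc 0 b)) {e : ℝ → E → E} {D D₁ : ℝ}
    (he : ∀ t ∈ Icc 0 b, ∀ q, ‖e t q‖ ≤ D) (hD₁ : D < D₁) {p : ℝ → E}
    (hp : IsIntegralCurveOn p (fun t q => g t q + e t q) (Icc 0 b))
    (hρ : A * ‖p 0 - x 0‖ + A * D₁ / k ≤ ρ) :
    ‖p b - x b‖ ≤ A * ‖p 0 - x 0‖ * Real.exp (-k * b) + A * D₁ / k := by
  set r := ‖p 0 - x 0‖ with hr
  have hr0 : 0 ≤ r := norm_nonneg _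
  have hD : 0 ≤ D := (norm_nonneg _).trans (he 0 ⟨le_rfl, hb⟩ 0)
  have hD₁0 : 0 ≤ A * D₁ / k := by have := hD.trans hD₁.le; positivity
  -- a step length for which the drift is dominated and below the threshold `δ`
  obtain ⟨h₀, hh₀, hdrift⟩ := (mem_nhdsGT_iff_exists_Ioo_subset).1 <|
    (eventually_gronwallBound_le (K := K) hk.ne' hD₁).and <|
      ((hasDerivAt_gronwallBound 0 K D 0).continuousAt.tendsto.mono_left
        nhdsWithin_le_nhds).eventually_le_const
        (show gronwallBound 0 K D 0 < δ by rwa [gronwallBound_x0])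
  have hh₀ : 0 < h₀ := hh₀
  obtain ⟨N, hN⟩ := exists_nat_gt (b / h₀)
  have hN0 : (0 : ℝ) < N := lt_of_le_of_lt (by positivity) hN
  set h := b / N with hh
  have hNh : N * h = b := by rw [hh]; field_simp
  have hh0 : 0 ≤ h := by positivity
  have hhh₀ : h < h₀ := by
    rw [hh, div_lt_iff₀ hN0]
    rw [div_lt_iff₀ hh₀] at hN
    linarith
  have hdrift' : gronwallBound 0 K D h ≤ D₁ / k * (1 - Real.exp (-k * h)) ∧
      gronwallBound 0 K D h ≤ δ := by
    rcases hh0.eq_or_lt with h0 | h0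
    · rw [← h0, gronwallBound_x0]
      exact ⟨by simp, hδ.le⟩
    · exact hdrift ⟨h0, hhh₀⟩
  -- `β n` is the weight of the chain of trajectories up to the one that leaves `p` at time `n h`
  set β : ℕ → ℝ := fun n => A * r + A * D₁ / k * (Real.exp (k * (n * h)) - 1) with hβ
  have hβle : ∀ n : ℕ, ∀ t, n * h ≤ t → β n * Real.exp (-k * t)
      ≤ A * r * Real.exp (-k * t) + A * D₁ / k := fun n t ht => by
    have h1 : Real.exp (k * (n * h)) * Real.exp (-k * t) ≤ 1 := by
      rw [← Real.exp_add, Real.exp_le_one_iff]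
      nlinarith
    have h2 : β n * Real.exp (-k * t) = A * r * Real.exp (-k * t) + A * D₁ / k *
      (Real.exp (k * (n * h)) * Real.exp (-k * t) - Real.exp (-k * t)) := by rw [hβ]; ring
    rw [h2]
    gcongr
    exact mul_le_of_le_one_right hD₁0 (by linarith [Real.exp_pos (-k * t)])
  have key : ∀ n : ℕ, n ≤ N → ∀ z : ℝ → E, IsIntegralCurveOn z g (Icc (n * h) b) →
      z (n * h) = p (n * h) → ∀ t ∈ Icc (n * h) b, ‖z t - x t‖ ≤ β n * Real.exp (-k * t) := by
    intro n
    induction n with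
    | zero =>
      intro _ z hz hz0
      simp only [Nat.cast_zero, zero_mul] at hz hz0 ⊢
      have := hC.norm_sub_le_of_segment hb hδ hA hk.le (hflow 0 ⟨le_rfl, hb⟩) hx hz
        (by rw [hz0]; linarith)
      simpa [hβ, hz0, ← hr] using this
    | succ n ih =>
      intro hn z hz hz0
      have hn0 : 0 ≤ n * h := by positivity
      have hsucc : ((n + 1 : ℕ) : ℝ) * h = n * h + h := by push_cast; ring
      have hle : n * h + h ≤ b := by
        rw [← hsucc, ← hNh]
        gcongr
      rw [hsucc] at hz hz0 ⊢
      obtain ⟨y, hy0, hy⟩ := hflow (n * h) ⟨hn0, by linarith⟩ (p (n * h))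
      have hmono : Icc (n * h + h) b ⊆ Icc (n * h) b := Icc_subset_Icc_left (by linarith)
      have hd := norm_sub_le_gronwallBound (a := n * h) (b := b)
        (fun t ht => hg t ⟨hn0.trans ht.1, ht.2⟩) (fun t ht => he t ⟨hn0.trans ht.1, ht.2⟩)
        (hp.mono (Icc_subset_Icc_left hn0)) hy hy0.symm (n * h + h) ⟨by linarith, hle⟩
      rw [add_sub_cancel_left, ← hz0] at hd
      refine hC.norm_sub_le_of_link ⟨by linarith, hle⟩ (hy.mono hmono) hz
        (fun t ht => ih (by omega) y hy hy0 t (hmono ht)) (fun t ht => ?_)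
        (hd.trans hdrift'.2) ?_
      · have ht0 : 0 ≤ t := by linarith [ht.1]
        have h2 : Real.exp (-k * t) ≤ 1 := Real.exp_le_one_iff.2 (by nlinarith)
        calc β n * Real.exp (-k * t) ≤ A * r * Real.exp (-k * t) + A * D₁ / k :=
              hβle n t (by linarith [ht.1])
          _ ≤ A * r * 1 + A * D₁ / k := by gcongr
          _ ≤ ρ := by simpa using hρ
      · calc β n + A * Real.exp (k * (n * h + h)) * ‖z (n * h + h) - y (n * h + h)‖
            ≤ β n + A * Real.exp (k * (n * h + h)) * (D₁ / k * (1 - Real.exp (-k * h))) := by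
              gcongr
              exact hd.trans hdrift'.1
          _ = β (n + 1) := by
              have : Real.exp (k * (n * h + h)) * Real.exp (-k * h) = Real.exp (k * (n * h)) := by
                rw [← Real.exp_add]
                ring_nf
              simp only [hβ, hsucc]
              linear_combination (-(A * D₁ / k)) * this
  obtain ⟨z, hz0, hz⟩ := hflow b ⟨hb, le_rfl⟩ (p b)
  have := key N le_rfl z (by rwa [hNh]) (by rwa [hNh]) b ⟨hNh.le, le_rfl⟩
  rw [hz0] at this
  exact this.trans (hβle N b hNh.le)

end Tracking

/-! ### Robustness of the contraction region -/

section Robustness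

open scoped NNReal Topology

variable {m : ℕ}

/-- Multiplying a smooth field by a bump function makes it bounded and globally Lipschitz,
uniformly over a compact time interval. -/
theorem SmoothOn.exists_bump_smul_bounds {f : ℝ → State m → State m} (hf : SmoothOn f univ)
    {c : State m} (η : ContDiffBump c) (b : ℝ) : ∃ K L : ℝ≥0, ∀ t ∈ Icc 0 b,
      LipschitzWith K (fun q => η q • f t q) ∧ ∀ q, ‖η q • f t q‖ ≤ L := by
  -- a cutoff in time as well gives a compactly supported field on space-time
  let θ : ContDiffBump (0 : ℝ) := ⟨|b| + 1, |b| + 2, by positivity, by linarith⟩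
  have hθ : ∀ t ∈ Icc 0 b, θ t = 1 := fun t ht => θ.one_of_mem_closedBall <| by
    rw [mem_closedBall_zero_iff, Real.norm_eq_abs, abs_of_nonneg ht.1]
    exact ht.2.trans ((le_abs_self b).trans (by simp [θ]))
  let F : ℝ × State m → State m := fun p => (θ p.1 * η p.2) • f p.1 p.2
  have hF : ContDiff ℝ ∞ F :=
    ((θ.contDiff.comp contDiff_fst).mul (η.contDiff.comp contDiff_snd)).smul hf.contDiff
  have hFc : HasCompactSupport F := by
    refine HasCompactSupport.intro ((isCompact_closedBall (0 : ℝ) θ.rOut).prod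
      (isCompact_closedBall c η.rOut)) fun p hp => ?_
    have hzero : θ p.1 = 0 ∨ η p.2 = 0 := by
      by_contra! h
      exact hp ⟨ball_subset_closedBall (θ.support_eq ▸ h.1),
        ball_subset_closedBall (η.support_eq ▸ h.2)⟩
    rcases hzero with h | h <;> simp [F, h]
  obtain ⟨K, hK⟩ := hF.lipschitzWith_of_hasCompactSupport hFc (by simp)
  obtain ⟨L, hL⟩ := hFc.exists_bound_of_continuous hF.continuous
  have hFη : ∀ t ∈ Icc 0 b, ∀ q, F (t, q) = η q • f t q := fun t ht q => by simp [F, hθ t ht]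
  refine ⟨K, L.toNNReal, fun t ht => ⟨LipschitzWith.of_dist_le_mul fun p q => ?_, fun q => ?_⟩⟩
  · rw [← hFη t ht, ← hFη t ht]
    simpa [Prod.dist_eq] using hK.dist_le_mul (t, p) (t, q)
  · rw [← hFη t ht]
    exact (hL _).trans (Real.le_coe_toNNReal L)

/-- On every compact time interval, the perturbed system has a solution that stays in the
contraction region and obeys the robustness bound. -/
theorem IsContractionRegion.exists_perturbed_solution
    {f d : ℝ → State m → State m} {M T : ℝ → State m → Op m}
    {c : State m} {b B lam chi D : ℝ} (hf : SmoothOn f univ) (hd : SmoothOn d univ) (hbB : b < B)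
    (hM : IsContractionRegion f M lam (ball c B))
    (hT : ∀ t, 0 ≤ t → ∀ y ∈ ball c B, M t y = ContinuousLinearMap.adjoint (T t y) ∘L T t y)
    (hchi : IsCondBound T (ball c B) chi)
    (hD : ∀ t, 0 ≤ t → ∀ y ∈ ball c B, ‖d t y‖ ≤ D) {x : ℝ → State m}
    (hx : IsIntegralCurveOn x f (Ici 0)) (hxb : ∀ t, 0 ≤ t → x t ∈ ball c b)
    {p : State m} (hp : ‖x 0 - p‖ ≤ b) (hB : b * (chi + 1) + chi * D / lam ≤ B)
    {τ : ℝ} (hτ : 0 ≤ τ) :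
    ∃ z : ℝ → State m, z 0 = p ∧ IsIntegralCurveOn z (fun t y => f t y + d t y) (Icc 0 τ) ∧
      ∀ t ∈ Icc 0 τ, z t ∈ ball c B ∧
        ‖x t - z t‖ ≤ chi * ‖x 0 - p‖ * Real.exp (-lam * t) + D * chi / lam := by
  obtain ⟨lo, hi, hlo, hlohi, hratio, hTb⟩ := hchi
  have hlam := hM.rate_pos
  have hhi : 0 < hi := hlo.trans_le hlohi
  have hchi1 : 1 ≤ chi := ((one_le_div hlo).2 hlohi).trans hratio
  have hchi0 : 0 < chi := by linarith
  have hx0 : x 0 ∈ ball c b := hxb 0 le_rfl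
  have hb : 0 < b := pos_of_mem_ball hx0
  -- the nominal trajectory keeps a positive distance to the boundary of the inner ball
  obtain ⟨b', hb'b, hxb'⟩ : ∃ b' < b, ∀ t ∈ Icc 0 τ, x t ∈ closedBall c b' := by
    obtain ⟨s, hs, hmax⟩ := isCompact_Icc.exists_isMaxOn (nonempty_Icc.2 hτ)
      ((continuous_id.dist (continuous_const (y := c))).comp_continuousOn
        (hx.mono Icc_subset_Ici_self).continuousOn)
    exact ⟨dist (x s) c, hxb s hs.1, fun t ht => hmax ht⟩
  have hb'0 : 0 ≤ b' := dist_nonneg.trans (hxb' 0 ⟨le_rfl, hτ⟩)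
  have hD0 : 0 ≤ D := (norm_nonneg _).trans (hD 0 le_rfl _ (ball_subset_ball hbB.le hx0))
  set S := chi * ‖x 0 - p‖ + chi * D / lam with hS
  have hS0 : 0 ≤ S := by positivity
  have hSB : S < B - b' := by nlinarith
  obtain ⟨ρ, hSρ, hρB⟩ := exists_between hSB
  obtain ⟨R, hρR, hRB⟩ := exists_between (show b' + ρ < B by linarith)
  obtain ⟨R', hRR', hR'B⟩ := exists_between hRB
  -- the fields `f` and `d`, cut off outside the ball of radius `R`
  let η : ContDiffBump c := ⟨R, R', by linarith, hRR'⟩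
  have hη : ∀ y ∈ closedBall c R, η y = 1 := fun y hy => η.one_of_mem_closedBall hy
  let g : ℝ → State m → State m := fun t y => η y • f t y
  let e : ℝ → State m → State m := fun t y => η y • d t y
  obtain ⟨K, L, hg⟩ := hf.exists_bump_smul_bounds η τ
  obtain ⟨K', L', he⟩ := hd.exists_bump_smul_bounds η τ
  have hgc : ∀ q, Continuous (fun t => g t q) := fun q =>
    (hf.contDiff.continuous.comp (Continuous.prodMk_left q)).const_smul (η q)
  have hec : ∀ q, Continuous (fun t => e t q) := fun q =>
    (hd.contDiff.continuous.comp (Continuous.prodMk_left q)).const_smul (η q)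
  have heD : ∀ t ∈ Icc 0 τ, ∀ q, ‖e t q‖ ≤ D := fun t ht q => by
    by_cases hq : q ∈ ball c B
    · rw [norm_smul, Real.norm_of_nonneg η.nonneg]
      exact (mul_le_of_le_one_left (norm_nonneg _) η.le_one).trans (hD t ht.1 q hq)
    · have : η q = 0 := η.zero_of_le_dist (hR'B.le.trans (not_lt.1 hq))
      simpa [e, this] using hD0
  have hgf : ∀ t, ∀ y ∈ closedBall c R, g t y = f t y := fun t y hy => by simp [g, hη y hy]
  have hxg : IsIntegralCurveOn x g (Icc 0 τ) :=
    (hx.mono Icc_subset_Ici_self).congr_field fun t ht =>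
      hgf t _ (closedBall_subset_closedBall (by linarith) (hxb' t ht))
  obtain ⟨z, hz0, hz⟩ := exists_isIntegralCurveOn_Icc (v := fun t q => g t q + e t q) hτ
    (fun t ht => (hg t ht).1.add (he t ht).1) (fun q => ((hgc q).add (hec q)).continuousOn)
    (L := L + L')
    (fun t ht q => (norm_add_le _ _).trans (add_le_add ((hg t ht).2 q) ((he t ht).2 q))) p
  have hzx0 : ‖z 0 - x 0‖ = ‖x 0 - p‖ := by rw [hz0, norm_sub_rev]
  -- the tracking estimate with rates `k < lam` and disturbance levels `D + (lam - k) > D`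
  have htrack : ∀ t ∈ Icc 0 τ, ‖x t - z t‖ ≤
      chi * ‖x 0 - p‖ * Real.exp (-lam * t) + chi * D / lam := by
    intro t ht
    have hsub : Icc 0 t ⊆ Icc 0 τ := Icc_subset_Icc_right ht.2
    have hlim : ∀ u v : ℝ, Filter.Tendsto
        (fun k => u * Real.exp (-k * v) + chi * (D + (lam - k)) / k) (𝓝[<] lam)
        (𝓝 (u * Real.exp (-lam * v) + chi * D / lam)) := fun u v => by
      have : ContinuousAt
          (fun k => u * Real.exp (-k * v) + chi * (D + (lam - k)) / k) lam := by
        fun_prop (disch := exact hlam.ne')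
      simpa using this.tendsto.mono_left nhdsWithin_le_nhds
    refine ge_of_tendsto (hlim _ t) ?_
    filter_upwards [(hlim (chi * ‖x 0 - p‖) 0).eventually (gt_mem_nhds (by simpa using hSρ)),
      Ioo_mem_nhdsLT hlam] with k hkρ hk
    obtain ⟨δ, hδ, hC⟩ := hM.exists_local_contraction hf hT hlo hhi hTb hk.2 hρR hRB
      (fun s hs => (hg s (hsub hs)).1) (fun s _ => hgf s)
    have hC' : LocallyContracts g x t ρ chi k δ := fun a ha y z hy hz hyx hza s hs => by
      refine (hC a ha y z hy hz (fun s hs => ?_) hza s hs).trans (by gcongr)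
      have h1 := mem_closedBall_iff_norm.1 (hxb' s ⟨ha.1.trans hs.1, hs.2.trans ht.2⟩)
      rw [mem_closedBall_iff_norm, ← sub_add_sub_cancel (y s) (x s) c, add_comm b']
      exact (norm_add_le _ _).trans (add_le_add (hyx s hs) h1)
    have := hC'.norm_sub_le_of_perturbation ht.1 hδ hchi0.le hk.1
      (fun s hs => (hg s (hsub hs)).1)
      (fun a ha q => exists_isIntegralCurveOn_Icc ha.2
        (fun s hs => (hg s ⟨ha.1.trans hs.1, hs.2.trans ht.2⟩).1)
        (fun q => (hgc q).continuousOn)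
        (fun s hs => (hg s ⟨ha.1.trans hs.1, hs.2.trans ht.2⟩).2) q)
      (hxg.mono hsub) (D₁ := D + (lam - k)) (fun s hs => heD s (hsub hs))
      (by linarith [hk.2]) (hz.mono hsub)
      (by rw [hzx0]; simpa using hkρ.le)
    rwa [norm_sub_rev, hzx0] at this
  have hzR : ∀ t ∈ Icc 0 τ, z t ∈ closedBall c R := fun t ht => by
    have h1 := mem_closedBall_iff_norm.1 (hxb' t ht)
    have h2 : chi * ‖x 0 - p‖ * Real.exp (-lam * t) ≤ chi * ‖x 0 - p‖ :=
      mul_le_of_le_one_right (by positivity) (Real.exp_le_one_iff.2 (by nlinarith [ht.1]))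
    have h3 := htrack t ht
    rw [norm_sub_rev] at h3
    rw [mem_closedBall_iff_norm, ← sub_add_sub_cancel (z t) (x t) c]
    exact (norm_add_le _ _).trans (by linarith)
  refine ⟨z, hz0, hz.congr_field fun t ht => ?_, fun t ht =>
    ⟨closedBall_subset_ball hRB (hzR t ht), mul_comm D chi ▸ htrack t ht⟩⟩
  simp [g, e, hη _ (hzR t ht)]

end Robustness

theorem theorem5 (m : ℕ)
    -- the nominal vector field, the disturbance, the metric and its factor
    (f d : ℝ → State m → State m) (M T : ℝ → State m → Op m)
    (c : State m) (b B lam chi D : ℝ)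
    (hf : SmoothOn f univ) (hd : SmoothOn d univ)
    (hbB : b < B)
    -- the outer ball is a contraction region with metric `M = Tᵀ T` and rate `lam`
    (hM : IsContractionRegion f M lam (ball c B))
    (hT : ∀ t, 0 ≤ t → ∀ y ∈ ball c B, M t y = ContinuousLinearMap.adjoint (T t y) ∘L T t y)
    (hchi : IsCondBound T (ball c B) chi)
    -- the disturbance is bounded by `D`
    (hD : ∀ t, 0 ≤ t → ∀ y ∈ ball c B, ‖d t y‖ ≤ D)
    -- the nominal trajectory starts in the inner ball and stays in it
    (x : ℝ → State m) (hx : IsIntegralCurveOn x f (Ici 0))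
    (hxb : ∀ t, 0 ≤ t → x t ∈ ball c b)
    -- the initial state of the perturbed system
    (p : State m) (hp : ‖x 0 - p‖ ≤ b)
    (hB : b * (chi + 1) + chi * D / lam ≤ B) :
    -- the perturbed system has a solution for all time
    (∃ xp : ℝ → State m, IsIntegralCurveOn xp (fun t y => f t y + d t y) (Ici 0) ∧ xp 0 = p) ∧
    -- every solution, on any time interval `[0, τ)` or on `[0, ∞)`, stays in the outer ball
    -- and satisfies the robustness bound
    (∀ (I : Set ℝ) (xp : ℝ → State m), (I = Ici 0 ∨ ∃ τ : ℝ, I = Ico 0 τ) →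
      IsIntegralCurveOn xp (fun t y => f t y + d t y) I → xp 0 = p →
      ∀ t ∈ I, xp t ∈ ball c B ∧
        ‖x t - xp t‖ ≤ chi * ‖x 0 - xp 0‖ * Real.exp (-lam * t) + D * chi / lam) := by
  have hv : ContDiff ℝ 1 (fun q : ℝ × State m => f q.1 q.2 + d q.1 q.2) :=
    (hf.contDiff.add hd.contDiff).of_le (by simp)
  have hsol := fun τ : ℝ => hM.exists_perturbed_solution hf hd hbB hT hchi hD hx hxb hp hB (τ := τ)
  refine ⟨hv.exists_isIntegralCurveOn_Ici fun τ hτ => ?_, fun I xp hI hxp hxp0 t ht => ?_⟩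
  · obtain ⟨z, hz0, hz, -⟩ := hsol τ hτ
    exact ⟨z, hz0, hz⟩
  · obtain ⟨ht0, hsub⟩ : 0 ≤ t ∧ Icc 0 t ⊆ I := by
      rcases hI with rfl | ⟨τ, rfl⟩
      · exact ⟨ht, Icc_subset_Ici_self⟩
      · exact ⟨ht.1, Icc_subset_Ico_right ht.2⟩
    obtain ⟨z, hz0, hz, hzb⟩ := hsol t ht0
    rw [hxp0, hv.eqOn_of_isIntegralCurveOn (hxp.mono hsub) hz (hxp0.trans hz0.symm)
      ⟨ht0, le_rfl⟩]
    exact hzb t ⟨ht0, le_rfl⟩
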